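/- The power graph $\mathcal{P}(G)$ of a group $G$ is the simple graph with vertex set $G$ in which two distinct vertices are adjacent whenever one of them is a positive power of the other; $\deg(x)$ denotes the degree of $x\in G$ in $\mathcal{P}(G)$ and $\delta(\mathcal{P}(G))$ the minimum degree of $\mathcal{P}(G)$. For a group $H$, let $\mathcal{M}(H)$ be the set of maximal cyclic subgroups of $H$, that is, of those cyclic subgroups of $H$ that are not properly contained in any cyclic subgroup of $H$; an element of $\mathcal{M}(H)$ is said to be of minimum order if its order is the least among the orders of the elements of $\mathcal{M}(H)$. Let $G$ be a finite noncyclic abelian group whose order has exactly two distinct prime divisors $p_1<p_2$, and let $P_i$ be the Sylow $p_i$-subgroup of $G$ for $i\in\{1,2\}$. Then the following hold: (i) If both $P_1$ and $P_2$ are noncyclic, then $\delta(\mathcal{P}(G))=\deg(y)$ for every $y\in G$ such that $\langle y\rangle\in\mathcal{M}(G)$ is of minimum order. (ii) If $P_1$ is noncyclic and $P_2$ is cyclic, then $\delta(\mathcal{P}(G))=\deg(y_1)$ for every $y_1\in P_1$ such that $\langle y_1\rangle\in\mathcal{M}(P_1)$ is of minimum order. (iii) If $P_1$ is cyclic and $P_2$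 is noncyclic, then $\delta(\mathcal{P}(G))=\deg(y_2)$ for every $y_2\in P_2$ such that $\langle y_2\rangle\in\mathcal{M}(P_2)$ is of minimum order. -/

import Mathlib

/-- The power graph of a group `G`: the vertices are the elements of `G`, and two distinct
vertices are adjacent when one of them is a positive power of the other. -/
def powerGraph (G : Type*) [Group G] : SimpleGraph G where
  Adj x y := x ≠ y ∧ ((∃ k : ℕ, 0 < k ∧ y = x ^ k) ∨ ∃ k : ℕ, 0 < k ∧ x = y ^ k)
  symm := ⟨fun _ _ h => ⟨h.1.symm, h.2.symm⟩⟩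
  loopless := ⟨fun _ h => h.1 rfl⟩

/-- The collection of all maximal cyclic subgroups of `G`: the cyclic subgroups of `G` that are
not properly contained in any cyclic subgroup of `G`. -/
def maximalCyclicSubgroups (G : Type*) [Group G] : Set (Subgroup G) :=
  {M | Maximal (fun K : Subgroup G => IsCyclic K) M}

/-- `M` is a maximal cyclic subgroup of `G` whose order is minimum among the orders of all
maximal cyclic subgroups of `G`. -/
def IsMinOrderMaximalCyclic {G : Type*} [Group G] (M : Subgroup G) : Prop :=
  M ∈ maximalCyclicSubgroups G ∧ ∀ K ∈ maximalCyclicSubgroups G, Nat.card M ≤ Nat.card K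

/- Write `f(x)` for the Euler totient of the order of `x` and `b(x)` for the number of `z` with
`⟨x⟩ < ⟨z⟩`. The closed neighbourhood of `x` is the disjoint union of `⟨x⟩` and of these `z`, so
`deg x + 1 = |x| + b(x)`. In a product of groups of coprime orders membership in `⟨z⟩` is
componentwise, hence `b(x) = b(x₁) b(x₂) + b(x₁) f(x₂) + f(x₁) b(x₂)`.

Everything then rests on lower bounds for `b` in a finite abelian `p`-group. If the group is not
cyclic and `⟨c⟩ ∋ x` is a maximal cyclic subgroup, some `t` of order `p` lies outside `⟨c⟩`, and the
products of the elements of `⟨c⟩ \ ⟨x⟩` with those of `⟨t⟩` show `p (|c| - |x|) ≤ b(x)`. If the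
group is cyclic, `b(x)` is the number of elements outside `⟨x⟩`. -/

open Subgroup

section Totient

theorem totient_le_totient_add_sub {a b : ℕ} (h : a ∣ b) : b.totient ≤ a.totient + (b - a) := by
  have hsub : (Finset.range b).filter b.Coprime ⊆
      (Finset.range a).filter a.Coprime ∪ Finset.Ico a b := by
    intro m hm
    have hmb := Finset.mem_filter.1 hm
    rcases lt_or_ge m a with hma | ham
    · exact Finset.mem_union_left _ (Finset.mem_filter.2
        ⟨Finset.mem_range.2 hma, hmb.2.coprime_dvd_left h⟩)
    · exact Finset.mem_union_right _ (Finset.mem_Ico.2 ⟨ham, Finset.mem_range.1 hmb.1⟩)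
  calc b.totient ≤ ((Finset.range a).filter a.Coprime ∪ Finset.Ico a b).card :=
        Finset.card_le_card hsub
    _ ≤ a.totient + (Finset.Ico a b).card := Finset.card_union_le _ _
    _ = a.totient + (b - a) := by rw [Nat.card_Ico]

theorem prime_pow_le_two_mul_totient {p : ℕ} (hp : p.Prime) (n : ℕ) :
    p ^ n ≤ 2 * (p ^ n).totient := by
  rcases n with - | n
  · simp
  · have h2 := hp.two_le
    calc p ^ (n + 1) = p ^ n * p := pow_succ p n
      _ ≤ p ^ n * (2 * (p - 1)) := Nat.mul_le_mul_left _ (by omega)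
      _ = 2 * (p ^ (n + 1)).totient := by rw [Nat.totient_prime_pow_succ hp, mul_left_comm]

end Totient

section PowerRoots

variable {G H : Type*} [Group G] [Group H]

/-- The proper power roots of `x`: the elements having `x` among their powers without being powers
of `x` themselves. They are the neighbours of `x` in the power graph outside `⟨x⟩`. -/
def properPowerRoots (x : G) : Set G := {z | zpowers x < zpowers z}

theorem mem_properPowerRoots_iff {x z : G} :
    z ∈ properPowerRoots x ↔ x ∈ zpowers z ∧ z ∉ zpowers x := by
  simp only [properPowerRoots, Set.mem_ofPred_eq, lt_iff_le_not_ge, zpowers_le]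

theorem properPowerRoots_one : properPowerRoots (1 : G) = {1}ᶜ := by
  ext z
  simp [mem_properPowerRoots_iff, one_mem]

theorem properPowerRoots_mulEquiv (e : G ≃* H) (x : G) :
    properPowerRoots (e x) = e '' properPowerRoots x := by
  have hmem (a b : G) : e a ∈ zpowers (e b) ↔ a ∈ zpowers b := by
    simp only [mem_zpowers_iff, ← map_zpow, e.injective.eq_iff]
  ext w
  obtain ⟨z, rfl⟩ := e.surjective w
  simp only [mem_properPowerRoots_iff, hmem, e.injective.mem_set_image]

theorem zpowers_mem_maximalCyclicSubgroups_iff {x : G} :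
    zpowers x ∈ maximalCyclicSubgroups G ↔ properPowerRoots x = ∅ := by
  change Maximal (fun K : Subgroup G => IsCyclic K) (zpowers x) ↔ _
  constructor
  · intro hx
    exact Set.eq_empty_of_forall_notMem fun z hz => hx.not_prop_of_gt hz inferInstance
  · refine fun h => maximal_iff_forall_gt.2 ⟨inferInstance, fun K hlt hK => ?_⟩
    obtain ⟨z, rfl⟩ := (Subgroup.isCyclic_iff_exists_zpowers_eq_top K).1 hK
    exact h.subset hlt

theorem isMinOrderMaximalCyclic_zpowers_iff {y : G} :
    IsMinOrderMaximalCyclic (zpowers y) ↔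
      properPowerRoots y = ∅ ∧ ∀ z : G, properPowerRoots z = ∅ → orderOf y ≤ orderOf z := by
  refine and_congr zpowers_mem_maximalCyclicSubgroups_iff ⟨fun h z hz => ?_, fun h K hK => ?_⟩
  · simpa only [Nat.card_zpowers] using h _ (zpowers_mem_maximalCyclicSubgroups_iff.2 hz)
  · obtain ⟨z, rfl⟩ := (Subgroup.isCyclic_iff_exists_zpowers_eq_top K).1 hK.1
    simpa only [Nat.card_zpowers] using h z (zpowers_mem_maximalCyclicSubgroups_iff.1 hK)

theorem exists_mem_zpowers_properPowerRoots_eq_empty [Finite G] (x : G) :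
    ∃ z : G, x ∈ zpowers z ∧ properPowerRoots z = ∅ := by
  obtain ⟨K, hxK, hK⟩ := Finite.exists_le_maximal (p := fun K : Subgroup G => IsCyclic K)
    (a := zpowers x) inferInstance
  obtain ⟨z, rfl⟩ := (Subgroup.isCyclic_iff_exists_zpowers_eq_top K).1 hK.prop
  exact ⟨z, zpowers_le.1 hxK, zpowers_mem_maximalCyclicSubgroups_iff.1 hK⟩

theorem ncard_coe_zpowers (x : G) : (zpowers x : Set G).ncard = orderOf x := by
  rw [← Nat.card_zpowers, ← Nat.card_coe_set_eq]
  rfl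

theorem orderOf_coprime_of_card_coprime (hco : (Nat.card G).Coprime (Nat.card H)) (x : G) (y : H) :
    (orderOf x).Coprime (orderOf y) :=
  hco.of_dvd (orderOf_dvd_natCard x) (orderOf_dvd_natCard y)

theorem orderOf_prod_of_card_coprime (hco : (Nat.card G).Coprime (Nat.card H)) (x : G × H) :
    orderOf x = orderOf x.1 * orderOf x.2 := by
  rw [Prod.orderOf, (orderOf_coprime_of_card_coprime hco x.1 x.2).lcm_eq_mul]

variable [Finite G] [Finite H]

theorem orderOf_le_of_mem_zpowers {x z : G} (h : x ∈ zpowers z) : orderOf x ≤ orderOf z :=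
  Nat.le_of_dvd (orderOf_pos z) (orderOf_dvd_of_mem_zpowers h)

theorem ncard_setOf_zpowers_eq (x : G) :
    {z : G | zpowers z = zpowers x}.ncard = (orderOf x).totient := by
  classical
  have := Fintype.ofFinite G
  have himage : {z : G | zpowers z = zpowers x} =
      (↑) '' {a : zpowers x | orderOf a = orderOf x} := by
    ext z
    simp only [Set.mem_ofPred_eq, Set.mem_image, Subtype.exists, ← Subgroup.orderOf_coe,
      exists_and_left, exists_prop]
    constructor
    · intro h
      exact ⟨z, by rw [← Nat.card_zpowers, h, Nat.card_zpowers], h ▸ mem_zpowers z, rfl⟩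
    · rintro ⟨z, ho, hz, rfl⟩
      exact eq_of_le_of_card_ge (zpowers_le.2 hz) (by rw [Nat.card_zpowers, Nat.card_zpowers, ho])
  rw [himage, Set.ncard_image_of_injective _ Subtype.val_injective, Set.ncard_eq_toFinset_card',
    Set.toFinset_ofPred]
  exact IsCyclic.card_orderOf_eq_totient (by rw [← Nat.card_eq_fintype_card, Nat.card_zpowers])

theorem ncard_setOf_mem_zpowers (x : G) :
    {z : G | x ∈ zpowers z}.ncard = (orderOf x).totient + (properPowerRoots x).ncard := by
  have hunion : {z : G | x ∈ zpowers z} =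
      {z : G | zpowers z = zpowers x} ∪ properPowerRoots x := by
    ext z
    simp only [properPowerRoots, Set.mem_union, Set.mem_ofPred_eq, ← zpowers_le (g := x),
      le_iff_eq_or_lt, eq_comm (a := zpowers x)]
  have hdisj : Disjoint {z : G | zpowers z = zpowers x} (properPowerRoots x) :=
    Set.disjoint_left.2 fun _ heq hlt => hlt.ne' heq
  rw [hunion, Set.ncard_union_eq hdisj, ncard_setOf_zpowers_eq]

theorem mem_zpowers_prod_iff (hco : (Nat.card G).Coprime (Nat.card H)) {x z : G × H} :
    x ∈ zpowers z ↔ x.1 ∈ zpowers z.1 ∧ x.2 ∈ zpowers z.2 := by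
  constructor
  · rintro ⟨k, rfl⟩
    exact ⟨⟨k, rfl⟩, ⟨k, rfl⟩⟩
  · rintro ⟨h₁, h₂⟩
    obtain ⟨i, hi⟩ := mem_powers_iff_mem_zpowers.2 h₁
    obtain ⟨j, hj⟩ := mem_powers_iff_mem_zpowers.2 h₂
    obtain ⟨k, hki, hkj⟩ := Nat.chineseRemainder hco i j
    have hk : z ^ k = x := Prod.ext
      ((pow_eq_pow_iff_modEq.2 (hki.of_dvd (orderOf_dvd_natCard z.1))).trans hi)
      ((pow_eq_pow_iff_modEq.2 (hkj.of_dvd (orderOf_dvd_natCard z.2))).trans hj)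
    exact hk ▸ npow_mem_zpowers z k

theorem ncard_properPowerRoots_prod (hco : (Nat.card G).Coprime (Nat.card H)) (x : G × H) :
    (properPowerRoots x).ncard =
      (properPowerRoots x.1).ncard * (properPowerRoots x.2).ncard +
      (properPowerRoots x.1).ncard * (orderOf x.2).totient +
      (orderOf x.1).totient * (properPowerRoots x.2).ncard := by
  have hprod : {z : G × H | x ∈ zpowers z} =
      {z | x.1 ∈ zpowers z} ×ˢ {z | x.2 ∈ zpowers z} := by
    ext z
    exact mem_zpowers_prod_iff hco
  have hcard := congrArg Set.ncard hprod
  rw [Set.ncard_prod, ncard_setOf_mem_zpowers, ncard_setOf_mem_zpowers, ncard_setOf_mem_zpowers,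
    orderOf_prod_of_card_coprime hco,
    Nat.totient_mul (orderOf_coprime_of_card_coprime hco x.1 x.2)] at hcard
  linarith

theorem properPowerRoots_prod_eq_empty (hco : (Nat.card G).Coprime (Nat.card H)) {x : G × H}
    (hx : properPowerRoots x = ∅) : properPowerRoots x.1 = ∅ ∧ properPowerRoots x.2 = ∅ := by
  have hcard := ncard_properPowerRoots_prod hco x
  have hf := Nat.totient_pos.2 (orderOf_pos x.1)
  have hg := Nat.totient_pos.2 (orderOf_pos x.2)
  rw [hx, Set.ncard_empty, eq_comm] at hcard
  simp only [Nat.add_eq_zero_iff, mul_eq_zero, hf.ne', hg.ne', or_false, false_or] at hcard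
  exact ⟨(Set.ncard_eq_zero).1 hcard.1.2, (Set.ncard_eq_zero).1 hcard.2⟩

end PowerRoots

section PGroup

variable {G : Type*} {p : ℕ} [hp : Fact p.Prime]

theorem orderOf_le_two_mul_totient_orderOf [Group G] (hG : IsPGroup p G) (x : G) :
    orderOf x ≤ 2 * (orderOf x).totient := by
  obtain ⟨n, hn⟩ := IsPGroup.iff_orderOf.1 hG x
  exact hn ▸ prime_pow_le_two_mul_totient hp.out n

theorem mem_zpowers_zpow_of_not_dvd [Group G] (hG : IsPGroup p G) (x : G) {k : ℤ}
    (hk : ¬ (p : ℤ) ∣ k) : x ∈ zpowers (x ^ k) := by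
  have hcop : p.Coprime k.natAbs :=
    (Nat.Prime.coprime_iff_not_dvd hp.out).2 (mt Int.natCast_dvd.2 hk)
  exact mem_zpowers_zpow_iff.2 (hG.orderOf_coprime hcop x).symm

theorem mem_zpowers_pow_of_mem_properPowerRoots [Group G] (hG : IsPGroup p G) {x z : G}
    (hz : z ∈ properPowerRoots x) : x ∈ zpowers (z ^ p) := by
  obtain ⟨⟨k, rfl⟩, hzx⟩ := mem_properPowerRoots_iff.1 hz
  obtain ⟨m, rfl⟩ : (p : ℤ) ∣ k := by
    by_contra hk
    exact hzx (mem_zpowers_zpow_of_not_dvd hG z hk)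
  exact ⟨m, by simp only [zpow_mul, zpow_natCast]⟩

theorem mem_zpowers_of_orderOf_dvd [Group G] [Finite G] [IsCyclic G] {x y : G}
    (h : orderOf x ∣ orderOf y) : x ∈ zpowers y := by
  classical
  have := Fintype.ofFinite G
  have hsub : (zpowers y : Set G).toFinset ⊆ Finset.univ.filter (· ^ orderOf y = 1) := by
    intro z hz
    exact Finset.mem_filter.2 ⟨Finset.mem_univ z, orderOf_dvd_iff_pow_eq_one.1
      (orderOf_dvd_of_mem_zpowers (Set.mem_toFinset.1 hz))⟩
  have hcard : (zpowers y : Set G).toFinset.card = orderOf y := by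
    rw [← Set.ncard_eq_toFinset_card', ncard_coe_zpowers]
  have heq := Finset.eq_of_subset_of_card_le hsub
    ((IsCyclic.card_pow_eq_one_le (orderOf_pos y)).trans_eq hcard.symm)
  exact Set.mem_toFinset.1 (heq ▸ Finset.mem_filter.2
    ⟨Finset.mem_univ x, orderOf_dvd_iff_pow_eq_one.1 h⟩)

theorem mem_properPowerRoots_of_notMem_zpowers [Group G] [Finite G] (hG : IsPGroup p G) {c x z : G}
    (hx : x ∈ zpowers c) (hz : z ∈ zpowers c) (hzx : z ∉ zpowers x) :
    z ∈ properPowerRoots x := by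
  have hmem {a b : G} (ha : a ∈ zpowers c) (hb : b ∈ zpowers c) (h : orderOf a ∣ orderOf b) :
      a ∈ zpowers b := by
    obtain ⟨k, hk⟩ := mem_zpowers_of_orderOf_dvd (x := (⟨a, ha⟩ : zpowers c)) (y := ⟨b, hb⟩)
      (by simpa only [Subgroup.orderOf_mk] using h)
    exact ⟨k, congrArg Subtype.val hk⟩
  obtain ⟨i, hi⟩ := IsPGroup.iff_orderOf.1 hG x
  obtain ⟨j, hj⟩ := IsPGroup.iff_orderOf.1 hG z
  have hij : i ≤ j := by
    by_contra! hji
    exact hzx (hmem hz hx (hi ▸ hj ▸ pow_dvd_pow p hji.le))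
  exact mem_properPowerRoots_iff.2 ⟨hmem hx hz (hi ▸ hj ▸ pow_dvd_pow p hij), hzx⟩

theorem ncard_properPowerRoots_add_orderOf [Group G] [Finite G] [IsCyclic G] (hG : IsPGroup p G)
    (x : G) : (properPowerRoots x).ncard + orderOf x = Nat.card G := by
  obtain ⟨c, hc⟩ := IsCyclic.exists_generator (α := G)
  have hcompl : properPowerRoots x = (zpowers x : Set G)ᶜ := Set.Subset.antisymm
    (fun _ hz => (mem_properPowerRoots_iff.1 hz).2)
    (fun z hz => mem_properPowerRoots_of_notMem_zpowers hG (hc x) (hc z) hz)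
  rw [hcompl, ← ncard_coe_zpowers, Set.ncard_compl_add_ncard]

theorem mem_zpowers_of_pow_mem_zpowers [CommGroup G] (hG : IsPGroup p G) {c x : G}
    (hc : properPowerRoots c = ∅) (htors : ∀ t : G, t ^ p = 1 → t ∈ zpowers c)
    (hx : x ^ p ∈ zpowers c) : x ∈ zpowers c := by
  obtain ⟨k, hk : c ^ k = x ^ p⟩ := hx
  by_cases hpk : (p : ℤ) ∣ k
  · obtain ⟨m, rfl⟩ := hpk
    have htorsion : (x / c ^ m) ^ p = 1 := by
      rw [div_pow, ← hk, ← zpow_natCast, ← zpow_mul, mul_comm m, div_self']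
    simpa using mul_mem (htors _ htorsion) (zpow_mem (mem_zpowers c) m)
  · have hcx : c ∈ zpowers x :=
      zpowers_le.2 (npow_mem_zpowers x p) (hk ▸ mem_zpowers_zpow_of_not_dvd hG c hpk)
    by_contra hxc
    exact hc.subset (mem_properPowerRoots_iff.2 ⟨hcx, hxc⟩)

theorem exists_orderOf_eq_notMem_zpowers [CommGroup G] (hG : IsPGroup p G) (hcyc : ¬ IsCyclic G)
    {c : G} (hc : properPowerRoots c = ∅) : ∃ t : G, orderOf t = p ∧ t ∉ zpowers c := by
  suffices h : ∃ t : G, t ^ p = 1 ∧ t ∉ zpowers c by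
    obtain ⟨t, ht, htc⟩ := h
    exact ⟨t, orderOf_eq_prime ht (by rintro rfl; exact htc (one_mem _)), htc⟩
  by_contra! htors
  have hmem (n : ℕ) (x : G) (hx : x ^ p ^ n ∈ zpowers c) : x ∈ zpowers c := by
    induction n with
    | zero => simpa using hx
    | succ n ih =>
      exact ih (mem_zpowers_of_pow_mem_zpowers hG hc htors (by rwa [← pow_mul, ← pow_succ]))
  refine hcyc ⟨c, fun x => ?_⟩
  obtain ⟨n, hn⟩ := hG x
  exact hmem n x (hn ▸ one_mem _)

theorem disjoint_zpowers_of_orderOf_prime [Group G] {K : Subgroup G} {t : G} (ht : orderOf t = p)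
    (htK : t ∉ K) : Disjoint K (zpowers t) := by
  have hcard : Nat.card (zpowers t) = p := (Nat.card_zpowers t).trans ht
  have : Fact (Nat.card (zpowers t)).Prime := ⟨hcard ▸ hp.out⟩
  rcases (K.subgroupOf (zpowers t)).eq_bot_or_eq_top_of_prime_card with h | h
  · exact subgroupOf_eq_bot.1 h
  · exact absurd (subgroupOf_eq_top.1 h (mem_zpowers t)) htK

theorem mul_mem_properPowerRoots [CommGroup G] (hG : IsPGroup p G) {c x z s : G}
    (hx : x ∈ zpowers c) (hz : z ∈ properPowerRoots x) (hzc : z ∈ zpowers c) (hs : s ^ p = 1)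
    (hsc : s ∈ zpowers c → s = 1) : z * s ∈ properPowerRoots x := by
  refine mem_properPowerRoots_iff.2 ⟨?_, fun hzs => ?_⟩
  · have hpow : (z * s) ^ p = z ^ p := by rw [mul_pow, hs, mul_one]
    have hxzs : x ∈ zpowers ((z * s) ^ p) := hpow ▸ mem_zpowers_pow_of_mem_properPowerRoots hG hz
    exact zpowers_le.2 (npow_mem_zpowers (z * s) p) hxzs
  · have hs1 : s = 1 := hsc ((mul_mem_cancel_left hzc).1 (zpowers_le.2 hx hzs))
    exact (mem_properPowerRoots_iff.1 hz).2 (by simpa [hs1] using hzs)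

theorem mul_orderOf_sub_le_ncard_properPowerRoots [CommGroup G] [Finite G] (hG : IsPGroup p G)
    (hcyc : ¬ IsCyclic G) {c x : G} (hx : x ∈ zpowers c) (hc : properPowerRoots c = ∅) :
    p * (orderOf c - orderOf x) ≤ (properPowerRoots x).ncard := by
  obtain ⟨t, ht, htc⟩ := exists_orderOf_eq_notMem_zpowers hG hcyc hc
  have hdisj : Disjoint (zpowers c) (zpowers t) := disjoint_zpowers_of_orderOf_prime ht htc
  let S : Set (G × G) := ((zpowers c : Set G) \ zpowers x) ×ˢ (zpowers t : Set G)
  have hS : S.ncard = p * (orderOf c - orderOf x) := by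
    rw [Set.ncard_prod, Set.ncard_sdiff (zpowers_le.2 hx), ncard_coe_zpowers, ncard_coe_zpowers,
      ncard_coe_zpowers, ht, mul_comm]
  have hinj : Set.InjOn (fun w : G × G => w.1 * w.2) S := by
    rintro ⟨z, s⟩ ⟨⟨hz, -⟩, hs⟩ ⟨z', s'⟩ ⟨⟨hz', -⟩, hs'⟩ h
    simpa using mul_injective_of_disjoint hdisj
      (a₁ := (⟨z, hz⟩, ⟨s, hs⟩)) (a₂ := (⟨z', hz'⟩, ⟨s', hs'⟩)) h
  rw [← hS]
  refine Set.ncard_le_ncard_of_injOn _ (fun w hw => ?_) hinj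
  obtain ⟨⟨hzc, hzx⟩, hs⟩ := hw
  exact mul_mem_properPowerRoots hG hx (mem_properPowerRoots_of_notMem_zpowers hG hx hzc hzx) hzc
    (orderOf_dvd_iff_pow_eq_one.1 (ht ▸ orderOf_dvd_of_mem_zpowers hs))
    (fun hsc => disjoint_def.1 hdisj hsc hs)

end PGroup

section Degree

theorem minDegree_eq_degree_of_forall_le {V : Type*} [Fintype V] {Γ : SimpleGraph V}
    [DecidableRel Γ.Adj] {v : V} (h : ∀ w, Γ.degree v ≤ Γ.degree w) :
    Γ.minDegree = Γ.degree v :=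
  have : Nonempty V := ⟨v⟩
  le_antisymm (Γ.minDegree_le_degree v) (Γ.le_minDegree_of_forall_le_degree _ h)

theorem powerGraph_adj_iff {G : Type*} [Group G] [Finite G] {x z : G} :
    (powerGraph G).Adj x z ↔ x ≠ z ∧ (z ∈ zpowers x ∨ x ∈ zpowers z) := by
  have hpow (a b : G) : (∃ k : ℕ, 0 < k ∧ b = a ^ k) ↔ b ∈ zpowers a := by
    constructor
    · rintro ⟨k, -, rfl⟩
      exact npow_mem_zpowers a k
    · intro h
      obtain ⟨k, rfl⟩ := mem_powers_iff_mem_zpowers.2 h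
      -- `k` may be `0`, so shift it by a period
      exact ⟨k + orderOf a, Nat.add_pos_right _ (orderOf_pos a), by simp [pow_add]⟩
  simp only [powerGraph, hpow]

theorem powerGraph_degree_add_one {G : Type*} [Group G] [Fintype G]
    [DecidableRel (powerGraph G).Adj] (x : G) :
    (powerGraph G).degree x + 1 = orderOf x + (properPowerRoots x).ncard := by
  classical
  have hclosed : (insert x ((powerGraph G).neighborFinset x) : Set G) =
      (zpowers x : Set G) ∪ properPowerRoots x := by
    ext z
    have hx : z = x → z ∈ zpowers x := by
      rintro rfl
      exact mem_zpowers z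
    simp only [SimpleGraph.coe_neighborFinset, Set.mem_insert_iff, SimpleGraph.mem_neighborSet,
      powerGraph_adj_iff, Set.mem_union, SetLike.mem_coe, mem_properPowerRoots_iff]
    tauto
  have hdisj : Disjoint (zpowers x : Set G) (properPowerRoots x) :=
    Set.disjoint_left.2 fun _ hz hroot => (mem_properPowerRoots_iff.1 hroot).2 hz
  rw [← ncard_coe_zpowers, ← Set.ncard_union_eq hdisj, ← hclosed, ← Finset.coe_insert,
    Set.ncard_coe_finset, Finset.card_insert_of_notMem (by simp),
    SimpleGraph.card_neighborFinset_eq_degree]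

variable {G H K : Type*} [Group G] [Fintype G] [DecidableRel (powerGraph G).Adj]

section Group

variable [Group H] [Group K] [Finite H] [Finite K]

theorem powerGraph_degree_mulEquiv_prod_add_one (hco : (Nat.card H).Coprime (Nat.card K))
    (e : H × K ≃* G) (x : H × K) :
    (powerGraph G).degree (e x) + 1 = orderOf x.1 * orderOf x.2 +
      ((properPowerRoots x.1).ncard * (properPowerRoots x.2).ncard +
      (properPowerRoots x.1).ncard * (orderOf x.2).totient +
      (orderOf x.1).totient * (properPowerRoots x.2).ncard) := by
  rw [powerGraph_degree_add_one, MulEquiv.orderOf_eq, properPowerRoots_mulEquiv,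
    Set.ncard_image_of_injective _ e.injective, orderOf_prod_of_card_coprime hco,
    ncard_properPowerRoots_prod hco]

theorem powerGraph_degree_mulEquiv_fst_add_one (hco : (Nat.card H).Coprime (Nat.card K))
    (e : H × K ≃* G) {y : H} (hy : properPowerRoots y = ∅) :
    (powerGraph G).degree (e (y, 1)) + 1 =
      orderOf y + (orderOf y).totient * (Nat.card K - 1) := by
  have hone : (properPowerRoots (1 : K)).ncard = Nat.card K - 1 := by
    rw [properPowerRoots_one, Set.ncard_compl, Set.ncard_singleton]
  simp [powerGraph_degree_mulEquiv_prod_add_one hco, hy, hone]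

end Group

variable [CommGroup H] [Finite H] {p q : ℕ} [hp : Fact p.Prime] [hq : Fact q.Prime]

section NotCyclic

variable [CommGroup K] [Finite K]

theorem orderOf_le_powerGraph_degree_add_one (hco : (Nat.card H).Coprime (Nat.card K))
    (e : H × K ≃* G) (hH : IsPGroup p H) (hK : IsPGroup q K) (hHc : ¬ IsCyclic H)
    (hKc : ¬ IsCyclic K) {x z : H × K} (hxz : x ∈ zpowers z) (hz : properPowerRoots z = ∅) :
    orderOf z ≤ (powerGraph G).degree (e x) + 1 := by
  obtain ⟨hxz₁, hxz₂⟩ := (mem_zpowers_prod_iff hco).1 hxz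
  obtain ⟨hz₁, hz₂⟩ := properPowerRoots_prod_eq_empty hco hz
  have ha := mul_orderOf_sub_le_ncard_properPowerRoots hH hHc hxz₁ hz₁
  have hb := mul_orderOf_sub_le_ncard_properPowerRoots hK hKc hxz₂ hz₂
  have hf := orderOf_le_two_mul_totient_orderOf hH x.1
  have hg := orderOf_le_two_mul_totient_orderOf hK x.2
  obtain ⟨d, hd⟩ := Nat.exists_eq_add_of_le (orderOf_le_of_mem_zpowers hxz₁)
  obtain ⟨l, hl⟩ := Nat.exists_eq_add_of_le (orderOf_le_of_mem_zpowers hxz₂)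
  rw [powerGraph_degree_mulEquiv_prod_add_one hco, orderOf_prod_of_card_coprime hco, hd, hl]
  rw [hd, Nat.add_sub_cancel_left] at ha
  rw [hl, Nat.add_sub_cancel_left] at hb
  replace ha := (Nat.mul_le_mul_right d hp.out.two_le).trans ha
  replace hb := (Nat.mul_le_mul_right l hq.out.two_le).trans hb
  generalize orderOf x.1 = u, orderOf x.2 = v, (properPowerRoots x.1).ncard = a,
    (properPowerRoots x.2).ncard = b at *
  have hab : d * l ≤ a * b := Nat.mul_le_mul (by lia) (by lia)
  have hav : d * v ≤ a * v.totient := by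
    calc d * v ≤ d * (2 * v.totient) := Nat.mul_le_mul_left d hg
      _ = 2 * d * v.totient := by ring
      _ ≤ a * v.totient := Nat.mul_le_mul_right _ ha
  have hub : u * l ≤ u.totient * b := by
    calc u * l ≤ 2 * u.totient * l := Nat.mul_le_mul_right l hf
      _ = u.totient * (2 * l) := by ring
      _ ≤ u.totient * b := Nat.mul_le_mul_left _ hb
  linarith

theorem powerGraph_minDegree_eq_of_not_isCyclic (hco : (Nat.card H).Coprime (Nat.card K))
    (e : H × K ≃* G) (hH : IsPGroup p H) (hK : IsPGroup q K) (hHc : ¬ IsCyclic H)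
    (hKc : ¬ IsCyclic K) {y : G} (hy : IsMinOrderMaximalCyclic (zpowers y)) :
    (powerGraph G).minDegree = (powerGraph G).degree y := by
  obtain ⟨hmax, hmin⟩ := isMinOrderMaximalCyclic_zpowers_iff.1 hy
  refine minDegree_eq_degree_of_forall_le fun w => ?_
  obtain ⟨x, rfl⟩ := e.surjective w
  obtain ⟨z, hxz, hz⟩ := exists_mem_zpowers_properPowerRoots_eq_empty x
  refine Nat.le_of_add_le_add_right (b := 1) ?_
  calc (powerGraph G).degree y + 1 = orderOf y := by
        rw [powerGraph_degree_add_one, hmax, Set.ncard_empty, add_zero]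
    _ ≤ orderOf (e z) := hmin _ (by rw [properPowerRoots_mulEquiv, hz, Set.image_empty])
    _ = orderOf z := e.orderOf_eq z
    _ ≤ (powerGraph G).degree (e x) + 1 :=
        orderOf_le_powerGraph_degree_add_one hco e hH hK hHc hKc hxz hz

end NotCyclic

section Cyclic

variable [Group K] [Finite K] [IsCyclic K]

theorem powerGraph_degree_mulEquiv_fst_le (hco : (Nat.card H).Coprime (Nat.card K))
    (e : H × K ≃* G) (hH : IsPGroup p H) (hK : IsPGroup q K) (hHc : ¬ IsCyclic H) {x : H × K}
    {z : H} (hxz : x.1 ∈ zpowers z) (hz : properPowerRoots z = ∅) :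
    (powerGraph G).degree (e (z, 1)) ≤ (powerGraph G).degree (e x) := by
  have ha := mul_orderOf_sub_le_ncard_properPowerRoots hH hHc hxz hz
  have hb := ncard_properPowerRoots_add_orderOf hK x.2
  have hv := orderOf_le_two_mul_totient_orderOf hK x.2
  have hw := totient_le_totient_add_sub (orderOf_dvd_of_mem_zpowers hxz)
  have hu := Nat.totient_le (orderOf x.1)
  obtain ⟨d, hd⟩ := Nat.exists_eq_add_of_le (orderOf_le_of_mem_zpowers hxz)
  obtain ⟨k, hk⟩ := Nat.exists_eq_add_of_le (orderOf_pos x.2)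
  refine Nat.le_of_add_le_add_right (b := 1) ?_
  rw [powerGraph_degree_mulEquiv_fst_add_one hco e hz,
    powerGraph_degree_mulEquiv_prod_add_one hco e x]
  rw [hd, Nat.add_sub_cancel_left] at ha hw
  replace ha := (Nat.mul_le_mul_right d hp.out.two_le).trans ha
  generalize orderOf x.1 = u, orderOf x.2 = v, (properPowerRoots x.1).ncard = a,
    (properPowerRoots x.2).ncard = b at *
  calc orderOf z + (orderOf z).totient * (Nat.card K - 1)
      ≤ u + d + (u.totient + d) * (b + k) := by rw [hd]; gcongr; lia
    _ = u + u.totient * k + d * (b + v) + u.totient * b := by rw [hk]; ring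
    _ ≤ u + u * k + d * (2 * b + 2 * v.totient) + u.totient * b := by gcongr; lia
    _ = u * v + (2 * d * b + 2 * d * v.totient + u.totient * b) := by rw [hk]; ring
    _ ≤ u * v + (a * b + a * v.totient + u.totient * b) := by gcongr

theorem powerGraph_minDegree_eq_of_isCyclic_snd (hco : (Nat.card H).Coprime (Nat.card K))
    (e : H × K ≃* G) (hH : IsPGroup p H) (hK : IsPGroup q K) (hHc : ¬ IsCyclic H) {y : H}
    (hy : IsMinOrderMaximalCyclic (zpowers y)) :
    (powerGraph G).minDegree = (powerGraph G).degree (e (y, 1)) := by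
  obtain ⟨hmax, hmin⟩ := isMinOrderMaximalCyclic_zpowers_iff.1 hy
  refine minDegree_eq_degree_of_forall_le fun w => ?_
  obtain ⟨x, rfl⟩ := e.surjective w
  obtain ⟨z, hxz, hz⟩ := exists_mem_zpowers_properPowerRoots_eq_empty x.1
  have hle : orderOf y ≤ orderOf z := hmin z hz
  have hdvd : orderOf y ∣ orderOf z := by
    obtain ⟨i, hi⟩ := IsPGroup.iff_orderOf.1 hH y
    obtain ⟨j, hj⟩ := IsPGroup.iff_orderOf.1 hH z
    rw [hi, hj] at hle ⊢
    exact pow_dvd_pow p ((Nat.pow_le_pow_iff_right hp.out.one_lt).1 hle)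
  have hφ : (orderOf y).totient ≤ (orderOf z).totient :=
    Nat.le_of_dvd (Nat.totient_pos.2 (orderOf_pos z)) (Nat.totient_dvd_of_dvd hdvd)
  refine le_trans (Nat.le_of_add_le_add_right (b := 1) ?_)
    (powerGraph_degree_mulEquiv_fst_le hco e hH hK hHc hxz hz)
  rw [powerGraph_degree_mulEquiv_fst_add_one hco e hmax,
    powerGraph_degree_mulEquiv_fst_add_one hco e hz]
  gcongr

end Cyclic

end Degree

section Sylow

variable {G : Type*} [CommGroup G]

theorem exists_prod_mulEquiv_of_isComplement' {H K : Subgroup G} (h : H.IsComplement' K) :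
    ∃ e : H × K ≃* G, ∀ x, e x = x.1 * x.2 :=
  ⟨MulEquiv.ofBijective (H.subtype.coprod K.subtype) h, fun _ => rfl⟩

theorem isComplement'_sylow_of_primeFactors_eq_pair [Finite G] {p q : ℕ} [Fact p.Prime]
    [Fact q.Prime] (hpq : p ≠ q) (hn : (Nat.card G).primeFactors = {p, q}) (P : Sylow p G)
    (Q : Sylow q G) : (P : Subgroup G).IsComplement' Q := by
  refine isComplement'_of_coprime ?_
    (IsPGroup.coprime_card_of_ne p q hpq _ _ P.isPGroup' Q.isPGroup')
  have hfactor := Nat.prod_factorization_pow_eq_self (n := Nat.card G) Nat.card_pos.ne'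
  rwa [Finsupp.prod, Nat.support_factorization, hn, Finset.prod_pair hpq,
    ← P.card_eq_multiplicity, ← Q.card_eq_multiplicity] at hfactor

end Sylow

theorem corollary1p5 {G : Type*} [CommGroup G] [Fintype G] [DecidableRel (powerGraph G).Adj]
    (hG : ¬ IsCyclic G) {p₁ p₂ : ℕ} (hlt : p₁ < p₂)
    (hn : (Nat.card G).primeFactors = {p₁, p₂})
    (P₁ : Sylow p₁ G) (P₂ : Sylow p₂ G) :
    (¬ IsCyclic P₁ → ¬ IsCyclic P₂ →
      ∀ y : G, IsMinOrderMaximalCyclic (Subgroup.zpowers y) →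
        (powerGraph G).minDegree = (powerGraph G).degree y) ∧
    (¬ IsCyclic P₁ → IsCyclic P₂ →
      ∀ y₁ : P₁, IsMinOrderMaximalCyclic (Subgroup.zpowers y₁) →
        (powerGraph G).minDegree = (powerGraph G).degree (y₁ : G)) ∧
    (IsCyclic P₁ → ¬ IsCyclic P₂ →
      ∀ y₂ : P₂, IsMinOrderMaximalCyclic (Subgroup.zpowers y₂) →
        (powerGraph G).minDegree = (powerGraph G).degree (y₂ : G)) := by
  have hp₁ : Fact p₁.Prime := ⟨Nat.prime_of_mem_primeFactors (n := Nat.card G) (by rw [hn]; simp)⟩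
  have hp₂ : Fact p₂.Prime := ⟨Nat.prime_of_mem_primeFactors (n := Nat.card G) (by rw [hn]; simp)⟩
  have hP₁ : IsPGroup p₁ P₁ := P₁.isPGroup'
  have hP₂ : IsPGroup p₂ P₂ := P₂.isPGroup'
  have hco : (Nat.card P₁).Coprime (Nat.card P₂) :=
    IsPGroup.coprime_card_of_ne p₁ p₂ hlt.ne _ _ hP₁ hP₂
  obtain ⟨e, he⟩ := exists_prod_mulEquiv_of_isComplement'
    (isComplement'_sylow_of_primeFactors_eq_pair hlt.ne hn P₁ P₂)
  refine ⟨fun h₁ h₂ y hy => ?_, fun h₁ h₂ y₁ hy₁ => ?_, fun h₁ h₂ y₂ hy₂ => ?_⟩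
  · exact powerGraph_minDegree_eq_of_not_isCyclic hco e hP₁ hP₂ h₁ h₂ hy
  · have he₁ : e (y₁, 1) = y₁ := by simp [he]
    exact he₁ ▸ powerGraph_minDegree_eq_of_isCyclic_snd hco e hP₁ hP₂ h₁ hy₁
  · have he₂ : MulEquiv.prodComm.trans e (y₂, 1) = y₂ := by simp [he]
    exact he₂ ▸ powerGraph_minDegree_eq_of_isCyclic_snd hco.symm (MulEquiv.prodComm.trans e)
      hP₂ hP₁ h₂ hy₂
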